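/- Let $M$ be a smooth manifold of dimension $n$ (Hausdorff, second countable, without boundary). For a smooth Riemannian metric $g$ on $M$ with Riemannian measure $dV_g$, and a set $E\subseteq M$ that is measurable with respect to (the completion of) $dV_g$ and has finite volume $\int_E dV_g<\infty$, the perimeter of $E$ is $$P_g(E)=\sup\Big\{\int_E \operatorname{div}_g(Y)\,dV_g \;:\; Y \text{ a smooth compactly supported vector field on } M,\ |Y|_g\le 1\Big\}\in[0,\infty],$$ and $E$ is called a set of finite $g$-perimeter if moreover $P_g(E)<\infty$. (a) Let $g_1,g_2$ be smooth Riemannian metrics on $M$ with $C^{-1}g_1\le g_2\le C g_1$ for some constant $C\ge 1$. Then every set $E\subseteq M$ of finite $g_1$-perimeter is also a set of finite $g_2$-perimeter, and $$C^{-\frac{n-1}{2}}\,P_{g_1}(E)\;\le\; P_{g_2}(E)\;\le\; C^{\frac{n-1}{2}}\,P_{g_1}(E).$$ (b) In particular, if $M$ is compact, then any two smooth Riemannian metrics $g_1,g_2$ on $M$ have the same class of sets of finite perimeter. -/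

import Mathlib

open Set MeasureTheory Manifold Bundle
open scoped ContDiff ENNReal Topology

noncomputable section

namespace RiemannianPerimeter

variable {n : ℕ} {M : Type*} [TopologicalSpace M] [ChartedSpace (EuclideanSpace ℝ (Fin n)) M]
  [IsManifold (𝓡 n) ∞ M]

/-- Smooth Riemannian metrics on the `n`-dimensional smooth manifold `M`. -/
abbrev Metric (n : ℕ) (M : Type*) [TopologicalSpace M]
    [ChartedSpace (EuclideanSpace ℝ (Fin n)) M] [IsManifold (𝓡 n) ∞ M] :=
  ContMDiffRiemannianMetric (𝓡 n) ∞ (EuclideanSpace ℝ (Fin n)) (fun p : M => TangentSpace (𝓡 n) p)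

/-- The coordinate vector `∂ᵢ` at `p` of the chart of `M` at `x₀`, for `p` in the domain of that
chart (the trivialization of the tangent bundle at `x₀` is the derivative of the chart at `x₀`). -/
def coordVector (x₀ p : M) (i : Fin n) : TangentSpace (𝓡 n) p :=
  (trivializationAt (EuclideanSpace ℝ (Fin n)) (TangentSpace (𝓡 n)) x₀).symmL ℝ p
    (EuclideanSpace.single i 1)

/-- The `i`-th component at `p`, in the chart at `x₀`, of the vector field `Y`. -/
def coordComponent (x₀ : M) (Y : ∀ p : M, TangentSpace (𝓡 n) p) (i : Fin n) (p : M) : ℝ :=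
  ((trivializationAt (EuclideanSpace ℝ (Fin n)) (TangentSpace (𝓡 n)) x₀).continuousLinearMapAt ℝ p
    (Y p) : EuclideanSpace ℝ (Fin n)) i

/-- The matrix `g_{ij} = g(∂ᵢ, ∂ⱼ)` at `p` of the metric `g` in the chart at `x₀`. -/
def coordMatrix (g : Metric n M) (x₀ p : M) : Matrix (Fin n) (Fin n) ℝ :=
  Matrix.of fun i j => g.inner p (coordVector x₀ p i) (coordVector x₀ p j)

/-- The volume density `√(det g_{ij})` at `p` of the metric `g` in the chart at `x₀`. -/
def volDensity (g : Metric n M) (x₀ p : M) : ℝ :=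
  Real.sqrt (coordMatrix g x₀ p).det

/-- The Riemannian divergence
`div Y = (√det g)⁻¹ ∑ᵢ ∂ᵢ (√det g Yⁱ)` at `p`, computed in the chart at `p`. -/
def divergence (g : Metric n M) (Y : ∀ p : M, TangentSpace (𝓡 n) p) (p : M) : ℝ :=
  (volDensity g p p)⁻¹ * ∑ i : Fin n,
    fderiv ℝ (fun y : EuclideanSpace ℝ (Fin n) =>
        volDensity g p ((extChartAt (𝓡 n) p).symm y) *
          coordComponent p Y i ((extChartAt (𝓡 n) p).symm y))
      (extChartAt (𝓡 n) p p) (EuclideanSpace.single i 1)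

variable [MeasurableSpace M]

/-- The measure `√(det g_{ij}) dx` on the domain of the chart at `x₀`, extended by zero to `M`. -/
def chartVolume (g : Metric n M) (x₀ : M) : Measure M :=
  (((volume : Measure (EuclideanSpace ℝ (Fin n))).restrict (extChartAt (𝓡 n) x₀).target).map
    (extChartAt (𝓡 n) x₀).symm).withDensity fun p => ENNReal.ofReal (volDensity g x₀ p)

/-- The Riemannian measure `dV_g`. The measures `√(det g_{ij}) dx` of two charts agree on the
overlap of their domains, and `dV_g` is the measure on `M` that restricts to them: it is the
smallest measure that is at least each of them. -/
def riemannianVolume (g : Metric n M) : Measure M :=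
  ⨆ x₀ : M, chartVolume g x₀

/-- Smooth compactly supported vector fields `Y` on `M` with `|Y|_g ≤ 1`. -/
structure IsTestField (g : Metric n M) (Y : ∀ p : M, TangentSpace (𝓡 n) p) : Prop where
  smooth : ContMDiff (𝓡 n) (𝓡 n).tangent ∞ (fun p => (⟨p, Y p⟩ : TangentBundle (𝓡 n) M))
  compact_support : IsCompact (closure {p : M | Y p ≠ 0})
  norm_le_one : ∀ p : M, Real.sqrt (g.inner p (Y p) (Y p)) ≤ 1

/-- The perimeter `P_g(E) = sup {∫_E div Y dV_g : Y ∈ 𝔛_c(M), |Y|_g ≤ 1} ∈ [0, ∞]`. The supremum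
is nonnegative, as `Y = 0` is allowed. -/
def perimeter (g : Metric n M) (E : Set M) : ℝ≥0∞ :=
  ⨆ (Y : ∀ p : M, TangentSpace (𝓡 n) p) (_ : IsTestField g Y),
    ENNReal.ofReal (∫ p in E, divergence g Y p ∂(riemannianVolume g))

/-- `E` is a set of finite perimeter: it is measurable with respect to (the completion of) `dV_g`,
has finite volume and has finite perimeter. -/
structure HasFinitePerimeter (g : Metric n M) (E : Set M) : Prop where
  measurable : NullMeasurableSet E (riemannianVolume g)
  volume_lt_top : riemannianVolume g E < ⊤
  perimeter_lt_top : perimeter g E < ⊤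

end RiemannianPerimeter

end

/-! Let ρ be the density of dV_{g₂} with respect to dV_{g₁}, a smooth positive function. The
coordinate formula for the divergence gives ρ div_{g₂} Y = div_{g₁}(ρY), so ∫_E div_{g₂} Y dV_{g₂} =
∫_E div_{g₁}(ρY) dV_{g₁} (`divergence_densityRatio_smul`, `riemannianVolume_eq_withDensity`). It
remains to bound |ρY|_{g₁}. In a g₁-orthonormal basis diagonalizing g₂, with eigenvalues dᵢ ≤ C, one
has ρ² = ∏ dⱼ, hence ρ²|Y|²_{g₁} = ∑ᵢ (∏_{j≠i} dⱼ) dᵢ yᵢ² ≤ C^(n-1) |Y|²_{g₂}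
(`Matrix.PosDef.det_mul_dotProduct_le`). So ρY / C^((n-1)/2) is a test field for g₁ whenever Y is
one for g₂, which gives `perimeter_le`. Only g₂ ≤ C g₁ enters; exchanging the metrics gives the
other inequality. On a compact manifold such constants exist by continuity (`exists_inner_le`). -/

/-! ### Pairs of positive definite forms. -/

section PositiveDefinite

open Matrix

variable {n : ℕ} {A B : Matrix (Fin n) (Fin n) ℝ}

open scoped MatrixOrder in
/-- A positive definite and a symmetric real matrix can be diagonalized by the same congruence. -/
theorem Matrix.PosDef.exists_simultaneous_diagonalization (hA : A.PosDef) (hB : B.IsHermitian) :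
    ∃ (Q : Matrix (Fin n) (Fin n) ℝ) (d : Fin n → ℝ),
      IsUnit Q ∧ A = Qᵀ * Q ∧ B = Qᵀ * diagonal d * Q := by
  obtain ⟨R, hR⟩ : ∃ R : Matrix (Fin n) (Fin n) ℝ, A = star R * R :=
    CStarAlgebra.nonneg_iff_eq_star_mul_self.mp hA.posSemidef.nonneg
  rw [star_eq_conjTranspose, conjTranspose_eq_transpose_of_trivial] at hR
  have hRu : IsUnit R := by
    rw [isUnit_iff_isUnit_det, isUnit_iff_ne_zero]
    intro h
    have := hA.det_pos
    rw [hR, det_mul, h, mul_zero] at this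
    exact this.false
  have hRd : IsUnit R.det := R.isUnit_iff_isUnit_det.mp hRu
  have hRT : IsUnit Rᵀ.det := by rwa [det_transpose]
  -- In the coordinates given by `R` the form `A` is the identity, so the spectral theorem for the
  -- transformed `B` finishes by an orthogonal change of basis.
  have hS : (R⁻¹ᵀ * B * R⁻¹).IsHermitian := by
    have := isHermitian_conjTranspose_mul_mul R⁻¹ hB
    rwa [conjTranspose_eq_transpose_of_trivial] at this
  obtain ⟨V, d, hVV, hspec⟩ : ∃ (V : Matrix (Fin n) (Fin n) ℝ) (d : Fin n → ℝ),
      V * Vᵀ = 1 ∧ R⁻¹ᵀ * B * R⁻¹ = V * diagonal d * Vᵀ := by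
    refine ⟨hS.eigenvectorUnitary.1, hS.eigenvalues, ?_, ?_⟩
    · rw [← conjTranspose_eq_transpose_of_trivial hS.eigenvectorUnitary.1]
      exact Unitary.coe_mul_star_self hS.eigenvectorUnitary
    · rw [← conjTranspose_eq_transpose_of_trivial hS.eigenvectorUnitary.1]
      exact hS.spectral_theorem
  refine ⟨Vᵀ * R, d, ?_, ?_, ?_⟩
  · refine IsUnit.mul ?_ hRu
    exact IsUnit.of_mul_eq_one_right V hVV
  · rw [transpose_mul, transpose_transpose, Matrix.mul_assoc, ← Matrix.mul_assoc V, hVV,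
      Matrix.one_mul, hR]
  · have hB' : B = Rᵀ * (R⁻¹ᵀ * B * R⁻¹) * R := by
      rw [transpose_nonsing_inv, Matrix.mul_assoc, Matrix.mul_assoc, Matrix.mul_assoc,
        nonsing_inv_mul _ hRd, mul_one, ← Matrix.mul_assoc, mul_nonsing_inv _ hRT, one_mul]
    rw [hB', hspec, transpose_mul, transpose_transpose]
    simp only [Matrix.mul_assoc]

theorem Matrix.dotProduct_conj_diagonal_mulVec (Q : Matrix (Fin n) (Fin n) ℝ) (d v : Fin n → ℝ) :
    v ⬝ᵥ (Qᵀ * diagonal d * Q) *ᵥ v = ∑ i, d i * (Q *ᵥ v) i ^ 2 := by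
  rw [Matrix.mul_assoc, ← mulVec_mulVec, dotProduct_mulVec, vecMul_transpose, ← mulVec_mulVec,
    dotProduct]
  refine Finset.sum_congr rfl fun i _ => ?_
  rw [mulVec_diagonal]
  ring

theorem Matrix.dotProduct_transpose_mul_self_mulVec (Q : Matrix (Fin n) (Fin n) ℝ)
    (v : Fin n → ℝ) : v ⬝ᵥ (Qᵀ * Q) *ᵥ v = ∑ i, (Q *ᵥ v) i ^ 2 := by
  simpa using Q.dotProduct_conj_diagonal_mulVec 1 v

/-- Two positive definite matrices are simultaneously congruent to the identity and to a diagonal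
matrix with positive entries, which are bounded by any bound for the quotient of the forms. -/
theorem Matrix.PosDef.exists_simultaneous_diagonalization_pos (hA : A.PosDef) (hB : B.PosDef) :
    ∃ (Q : Matrix (Fin n) (Fin n) ℝ) (d : Fin n → ℝ),
      IsUnit Q ∧ A = Qᵀ * Q ∧ B = Qᵀ * diagonal d * Q ∧ (∀ i, 0 < d i) ∧
      ∀ C : ℝ, (∀ v : Fin n → ℝ, v ⬝ᵥ B *ᵥ v ≤ C * (v ⬝ᵥ A *ᵥ v)) → ∀ i, d i ≤ C := by
  obtain ⟨Q, d, hQ, rfl, rfl⟩ := hA.exists_simultaneous_diagonalization hB.isHermitian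
  have hQd : IsUnit Q.det := Q.isUnit_iff_isUnit_det.mp hQ
  -- On the vector `Q⁻¹ eᵢ` the two forms take the values `1` and `d i`.
  have hQe (i : Fin n) : Q *ᵥ (Q⁻¹ *ᵥ Pi.single i 1) = Pi.single i 1 := by
    rw [mulVec_mulVec, mul_nonsing_inv _ hQd, one_mulVec]
  refine ⟨Q, d, hQ, rfl, rfl, fun i => ?_, fun C hC i => ?_⟩
  · have hne : Q⁻¹ *ᵥ Pi.single i 1 ≠ 0 := by
      intro h
      have := hQe i
      rw [h, mulVec_zero] at this
      simpa using congrFun this i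
    have := hB.dotProduct_mulVec_pos hne
    rw [star_trivial, dotProduct_conj_diagonal_mulVec, hQe] at this
    simpa [Pi.single_apply] using this
  · have := hC (Q⁻¹ *ᵥ Pi.single i 1)
    rw [dotProduct_conj_diagonal_mulVec, dotProduct_transpose_mul_self_mulVec, hQe] at this
    simpa [Pi.single_apply] using this

theorem Matrix.PosDef.det_le_pow_mul_det (hA : A.PosDef) (hB : B.PosDef) {C : ℝ}
    (hC : ∀ v : Fin n → ℝ, v ⬝ᵥ B *ᵥ v ≤ C * (v ⬝ᵥ A *ᵥ v)) : B.det ≤ C ^ n * A.det := by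
  obtain ⟨Q, d, -, rfl, rfl, hd, hdC⟩ := hA.exists_simultaneous_diagonalization_pos hB
  have : ∏ i, d i ≤ C ^ n := by
    simpa using Finset.prod_le_prod (s := Finset.univ) (fun i _ => (hd i).le) fun i _ => hdC C hC i
  rw [det_mul, det_mul, det_mul, det_diagonal, det_transpose]
  nlinarith [mul_le_mul_of_nonneg_left this (mul_self_nonneg Q.det)]

/-- In the `i`-th summand one factor `d i` of the determinant is absorbed by the form `B`. The other
`n - 1` factors are at most `C`, whence the exponent in the theorem. -/
theorem Matrix.PosDef.det_mul_dotProduct_le (hA : A.PosDef) (hB : B.PosDef) {C : ℝ}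
    (hC : ∀ v : Fin n → ℝ, v ⬝ᵥ B *ᵥ v ≤ C * (v ⬝ᵥ A *ᵥ v)) (v : Fin n → ℝ) :
    B.det * (v ⬝ᵥ A *ᵥ v) ≤ C ^ (n - 1) * A.det * (v ⬝ᵥ B *ᵥ v) := by
  obtain ⟨Q, d, -, rfl, rfl, hd, hdC⟩ := hA.exists_simultaneous_diagonalization_pos hB
  rw [dotProduct_conj_diagonal_mulVec, dotProduct_transpose_mul_self_mulVec, det_mul, det_mul,
    det_mul, det_diagonal, det_transpose, Finset.mul_sum, Finset.mul_sum]
  refine Finset.sum_le_sum fun i _ => ?_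
  have : ∏ j ∈ Finset.univ.erase i, d j ≤ C ^ (n - 1) := by
    simpa using Finset.prod_le_prod (s := Finset.univ.erase i) (fun i _ => (hd i).le)
      fun i _ => hdC C hC i
  rw [← Finset.mul_prod_erase _ _ (Finset.mem_univ i)]
  have h := mul_le_mul_of_nonneg_left this
    (mul_nonneg (mul_self_nonneg Q.det) (mul_nonneg (hd i).le (sq_nonneg ((Q *ᵥ v) i))))
  linarith

/-- The trace is the sum of the `d i`, hence at least each of them; it serves as a bound visibly
continuous in the matrices. -/
theorem Matrix.PosDef.dotProduct_le_trace_mul (hA : A.PosDef) (hB : B.PosDef) (v : Fin n → ℝ) :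
    v ⬝ᵥ B *ᵥ v ≤ (A⁻¹ * B).trace * (v ⬝ᵥ A *ᵥ v) := by
  obtain ⟨Q, d, hQ, rfl, rfl, hd, -⟩ := hA.exists_simultaneous_diagonalization_pos hB
  have hQd : IsUnit Q.det := Q.isUnit_iff_isUnit_det.mp hQ
  have hQT : IsUnit Qᵀ.det := by rwa [det_transpose]
  have htr : ((Qᵀ * Q)⁻¹ * (Qᵀ * diagonal d * Q)).trace = ∑ i, d i := by
    rw [mul_inv_rev, Matrix.mul_assoc, Matrix.mul_assoc Qᵀ, ← Matrix.mul_assoc Qᵀ⁻¹,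
      nonsing_inv_mul _ hQT, one_mul, trace_mul_comm, Matrix.mul_assoc,
      mul_nonsing_inv _ hQd, mul_one, trace_diagonal]
  rw [htr, dotProduct_conj_diagonal_mulVec, dotProduct_transpose_mul_self_mulVec, Finset.mul_sum]
  exact Finset.sum_le_sum fun i _ => mul_le_mul_of_nonneg_right
    (Finset.single_le_sum (fun j _ => (hd j).le) (Finset.mem_univ i)) (sq_nonneg _)

end PositiveDefinite

/-! ### Measures with density. -/

theorem MeasureTheory.Measure.withDensity_mono_left {α : Type*} {_ : MeasurableSpace α}
    {μ ν : Measure α} (h : μ ≤ ν) (f : α → ℝ≥0∞) : μ.withDensity f ≤ ν.withDensity f :=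
  Measure.le_iff.mpr fun s hs => by
    rw [withDensity_apply _ hs, withDensity_apply _ hs]
    exact lintegral_mono' (Measure.restrict_mono le_rfl h) le_rfl

/-- Multiplication by `f` is monotone with monotone inverse, multiplication by `f⁻¹`, so it commutes
with suprema. This handles `riemannianVolume`, a supremum of chart measures. -/
theorem MeasureTheory.Measure.iSup_withDensity {α ι : Type*} {_ : MeasurableSpace α}
    (μ : ι → Measure α) {f : α → ℝ≥0∞} (hf : Measurable f) (h0 : ∀ x, f x ≠ 0)
    (ht : ∀ x, f x ≠ ⊤) : (⨆ i, μ i).withDensity f = ⨆ i, (μ i).withDensity f := by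
  refine le_antisymm ?_ (iSup_le fun i => withDensity_mono_left (le_iSup μ i) f)
  set ν := ⨆ i, (μ i).withDensity f
  have h : ⨆ i, μ i ≤ ν.withDensity fun x => (f x)⁻¹ := iSup_le fun i =>
    (withDensity_inv_same (μ := μ i) hf (.of_forall h0) (.of_forall ht)).symm.trans_le
      (withDensity_mono_left (le_iSup (fun i => (μ i).withDensity f) i) _)
  refine (withDensity_mono_left h f).trans_eq ?_
  simpa [Pi.inv_def] using withDensity_inv_same (μ := ν) hf.inv
    (.of_forall fun x => ENNReal.inv_ne_zero.mpr (ht x))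
    (.of_forall fun x => ENNReal.inv_ne_top.mpr (h0 x))

theorem MeasureTheory.setIntegral_withDensity_ofReal {α : Type*} {_ : MeasurableSpace α}
    {μ : Measure α} {f : α → ℝ} (hf : Measurable f) (h0 : ∀ x, 0 ≤ f x) {s : Set α}
    (hs : NullMeasurableSet s μ) (g : α → ℝ) :
    ∫ x in s, g x ∂(μ.withDensity fun x => ENNReal.ofReal (f x)) = ∫ x in s, f x * g x ∂μ := by
  obtain ⟨t, -, ht, hts⟩ := hs.exists_measurable_superset_ae_eq
  rw [setIntegral_congr_set hts.symm,
    setIntegral_congr_set ((withDensity_absolutelyContinuous μ _).ae_eq hts.symm),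
    restrict_withDensity ht]
  refine (integral_withDensity_eq_integral_smul (f := fun x => (f x).toNNReal)
    hf.real_toNNReal g).trans ?_
  refine integral_congr_ae (.of_forall fun x => ?_)
  simp [NNReal.smul_def, h0 x]

/-! ### Coordinate frames and metric matrices. -/

noncomputable section

namespace RiemannianPerimeter

open scoped Matrix

variable {n : ℕ} {M : Type*} [TopologicalSpace M] [ChartedSpace (EuclideanSpace ℝ (Fin n)) M]
  [IsManifold (𝓡 n) ∞ M]

/-- The domain of the chart at `x₀`, as the base set of the trivialization at `x₀`. -/
def frameDomain (n : ℕ) {M : Type*} [TopologicalSpace M]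
    [ChartedSpace (EuclideanSpace ℝ (Fin n)) M] [IsManifold (𝓡 n) ∞ M] (x₀ : M) : Set M :=
  (trivializationAt (EuclideanSpace ℝ (Fin n)) (TangentSpace (𝓡 n)) x₀).baseSet

theorem mem_frameDomain (n : ℕ) {M : Type*} [TopologicalSpace M]
    [ChartedSpace (EuclideanSpace ℝ (Fin n)) M] [IsManifold (𝓡 n) ∞ M] (x₀ : M) :
    x₀ ∈ frameDomain n x₀ :=
  FiberBundle.mem_baseSet_trivializationAt' x₀

theorem isOpen_frameDomain (x₀ : M) : IsOpen (frameDomain n x₀) :=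
  Trivialization.open_baseSet _

theorem frameDomain_eq_source (x₀ : M) : frameDomain n x₀ = (extChartAt (𝓡 n) x₀).source := by
  rw [frameDomain, TangentBundle.trivializationAt_baseSet, extChartAt_source]

theorem symmL_eq_sum_coordVector (x₀ p : M) (c : EuclideanSpace ℝ (Fin n)) :
    (trivializationAt (EuclideanSpace ℝ (Fin n)) (TangentSpace (𝓡 n)) x₀).symmL ℝ p c =
      ∑ i, c i • coordVector x₀ p i := by
  conv_lhs => rw [← (EuclideanSpace.basisFun (Fin n) ℝ).sum_repr c]
  simp [map_sum, map_smul, coordVector]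

/-- A tangent vector is the combination of the coordinate vectors with its components. -/
theorem eq_sum_coordVector {x₀ p : M} (hp : p ∈ frameDomain n x₀) (v : TangentSpace (𝓡 n) p) :
    v = ∑ i, ((trivializationAt (EuclideanSpace ℝ (Fin n)) (TangentSpace (𝓡 n))
      x₀).continuousLinearMapAt ℝ p v : EuclideanSpace ℝ (Fin n)) i • coordVector x₀ p i := by
  rw [← symmL_eq_sum_coordVector]
  exact (Trivialization.symmL_continuousLinearMapAt _ hp v).symm

theorem sum_smul_coordVector_eq_zero {x₀ p : M} (hp : p ∈ frameDomain n x₀) {c : Fin n → ℝ}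
    (h : ∑ i, c i • coordVector x₀ p i = 0) : c = 0 := by
  have h1 := symmL_eq_sum_coordVector x₀ p (WithLp.toLp 2 c)
  rw [h] at h1
  have h2 := Trivialization.continuousLinearMapAt_symmL (R := ℝ)
    (trivializationAt (EuclideanSpace ℝ (Fin n)) (TangentSpace (𝓡 n)) x₀) hp (WithLp.toLp 2 c)
  rw [h1, map_zero] at h2
  funext i
  exact (congrArg (fun w : EuclideanSpace ℝ (Fin n) => w i) h2).symm

theorem inner_sum_coordVector (g : Metric n M) (x₀ p : M) (c d : Fin n → ℝ) :
    g.inner p (∑ i, c i • coordVector x₀ p i) (∑ i, d i • coordVector x₀ p i) =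
      c ⬝ᵥ coordMatrix g x₀ p *ᵥ d := by
  simp only [map_sum, map_smul, _root_.sum_apply, _root_.smul_apply,
    smul_eq_mul, dotProduct, Matrix.mulVec, coordMatrix, Matrix.of_apply, Finset.mul_sum]
  rw [Finset.sum_comm]
  refine Finset.sum_congr rfl fun i _ => Finset.sum_congr rfl fun j _ => ?_
  ring

theorem posDef_coordMatrix (g : Metric n M) {x₀ p : M} (hp : p ∈ frameDomain n x₀) :
    (coordMatrix g x₀ p).PosDef := by
  refine Matrix.PosDef.of_dotProduct_mulVec_pos ?_ fun c hc => ?_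
  · ext i j
    simpa [coordMatrix] using g.symm p _ _
  · rw [star_trivial, ← inner_sum_coordVector]
    exact g.pos p _ fun h => hc (sum_smul_coordVector_eq_zero hp h)

theorem volDensity_pos (g : Metric n M) {x₀ p : M} (hp : p ∈ frameDomain n x₀) :
    0 < volDensity g x₀ p :=
  Real.sqrt_pos.mpr (posDef_coordMatrix g hp).det_pos

/-- The matrices of a metric in two charts are congruent, by a matrix that does not depend on the
metric. -/
theorem exists_coordMatrix_eq {x₀ p : M} (x₁ : M) (hp : p ∈ frameDomain n x₀) :
    ∃ A : Matrix (Fin n) (Fin n) ℝ, ∀ g : Metric n M,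
      coordMatrix g x₁ p = A * coordMatrix g x₀ p * A.transpose := by
  refine ⟨Matrix.of fun i => ((trivializationAt (EuclideanSpace ℝ (Fin n)) (TangentSpace (𝓡 n))
      x₀).continuousLinearMapAt ℝ p (coordVector x₁ p i) : EuclideanSpace ℝ (Fin n)), fun g => ?_⟩
  ext i j
  conv_lhs => rw [coordMatrix, Matrix.of_apply, eq_sum_coordVector hp (coordVector x₁ p i),
    eq_sum_coordVector hp (coordVector x₁ p j), inner_sum_coordVector]
  rw [Matrix.mul_assoc, Matrix.mul_apply']
  rfl

/-! ### The density ratio: independence of the chart, smoothness, bounds. -/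

/-- The density of the Riemannian measure of `g₂` with respect to that of `g₁`. -/
def densityRatio (g₁ g₂ : Metric n M) (p : M) : ℝ :=
  volDensity g₂ p p / volDensity g₁ p p

theorem densityRatio_pos (g₁ g₂ : Metric n M) (p : M) : 0 < densityRatio g₁ g₂ p :=
  div_pos (volDensity_pos g₂ (mem_frameDomain n p)) (volDensity_pos g₁ (mem_frameDomain n p))

/-- The ratio of the volume densities of two metrics does not depend on the chart. -/
theorem volDensity_eq_mul (g₁ g₂ : Metric n M) {x₀ p : M} (hp : p ∈ frameDomain n x₀) :
    volDensity g₂ x₀ p = densityRatio g₁ g₂ p * volDensity g₁ x₀ p := by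
  obtain ⟨A, hA⟩ := exists_coordMatrix_eq p hp
  -- The Jacobian factor is the same for both metrics and cancels in the quotient.
  have key (g : Metric n M) : volDensity g p p = |A.det| * volDensity g x₀ p := by
    rw [volDensity, volDensity, hA, Matrix.det_mul, Matrix.det_mul, Matrix.det_transpose,
      mul_right_comm, ← sq, Real.sqrt_mul (sq_nonneg _), Real.sqrt_sq_eq_abs]
  have h1 := volDensity_pos g₁ (mem_frameDomain n p)
  have h2 := (volDensity_pos g₁ hp).ne'
  rw [key] at h1
  have hA0 : |A.det| ≠ 0 := fun h => by simp [h] at h1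
  rw [densityRatio, key, key]
  field_simp

theorem densityRatio_eq (g₁ g₂ : Metric n M) {x₀ p : M} (hp : p ∈ frameDomain n x₀) :
    densityRatio g₁ g₂ p = volDensity g₂ x₀ p / volDensity g₁ x₀ p := by
  rw [volDensity_eq_mul g₁ g₂ hp, mul_div_cancel_right₀ _ (volDensity_pos g₁ hp).ne']

theorem contMDiffAt_coordVector {x₀ p : M} (hp : p ∈ frameDomain n x₀) (i : Fin n) :
    ContMDiffAt (𝓡 n) (𝓡 n).tangent ∞
      (fun q => (⟨q, coordVector x₀ q i⟩ : TangentBundle (𝓡 n) M)) p := by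
  have h := contMDiffAt_localFrame_of_mem (I := 𝓡 n) ∞
    (trivializationAt (EuclideanSpace ℝ (Fin n)) (TangentSpace (𝓡 n) : M → Type) x₀)
    (EuclideanSpace.basisFun (Fin n) ℝ).toBasis i hp
  refine h.congr_of_eventuallyEq ?_
  filter_upwards [(isOpen_frameDomain x₀).mem_nhds hp] with q hq
  rw [Trivialization.localFrame_apply_of_mem_baseSet _ _ hq]
  simp only [coordVector, Trivialization.basisAt, Module.Basis.map_apply,
    OrthonormalBasis.coe_toBasis, EuclideanSpace.basisFun_apply]
  exact congrArg _ (Trivialization.symmL_apply (R := ℝ) _ hq _)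

theorem contMDiffAt_coordMatrix (g : Metric n M) {x₀ p : M} (hp : p ∈ frameDomain n x₀)
    (i j : Fin n) :
    ContMDiffAt (𝓡 n) 𝓘(ℝ) ∞ (fun q => coordMatrix g x₀ q i j) p := by
  have : ContMDiffAt (𝓡 n) ((𝓡 n).prod 𝓘(ℝ)) ∞
      (fun q => TotalSpace.mk' ℝ (E := Bundle.Trivial M ℝ) q
        (g.inner q (coordVector x₀ q i) (coordVector x₀ q j))) p :=
    ContMDiffAt.clm_bundle_apply₂ (F₁ := EuclideanSpace ℝ (Fin n))
      (F₂ := EuclideanSpace ℝ (Fin n)) g.contMDiff.contMDiffAt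
      (contMDiffAt_coordVector hp i) (contMDiffAt_coordVector hp j)
  simp only [contMDiffAt_totalSpace] at this
  exact this.2

theorem contMDiffAt_volDensity (g : Metric n M) {x₀ p : M} (hp : p ∈ frameDomain n x₀) :
    ContMDiffAt (𝓡 n) 𝓘(ℝ) ∞ (volDensity g x₀) p := by
  have hdet : ContMDiffAt (𝓡 n) 𝓘(ℝ) ∞ (fun q => (coordMatrix g x₀ q).det) p := by
    simp only [Matrix.det_apply']
    refine ContMDiffAt.sum fun σ _ => contMDiffAt_const.mul ?_
    exact contMDiffAt_finsetProd fun i _ => contMDiffAt_coordMatrix g hp _ _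
  exact (Real.contDiffAt_sqrt
    (posDef_coordMatrix g hp).det_pos.ne').contMDiffAt.comp p hdet

theorem contMDiff_densityRatio (g₁ g₂ : Metric n M) :
    ContMDiff (𝓡 n) 𝓘(ℝ) ∞ (densityRatio g₁ g₂) := fun x₀ => by
  refine ((contMDiffAt_volDensity g₂ (mem_frameDomain n x₀)).div₀
    (contMDiffAt_volDensity g₁ (mem_frameDomain n x₀))
    (volDensity_pos g₁ (mem_frameDomain n x₀)).ne').congr_of_eventuallyEq ?_
  filter_upwards [(isOpen_frameDomain x₀).mem_nhds (mem_frameDomain n x₀)] with p hp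
  exact densityRatio_eq g₁ g₂ hp

theorem inner_self_nonneg (g : Metric n M) (p : M) (v : TangentSpace (𝓡 n) p) :
    0 ≤ g.inner p v v := by
  rcases eq_or_ne v 0 with rfl | hv
  · simp
  · exact (g.pos p v hv).le

theorem dotProduct_coordMatrix_le {g₁ g₂ : Metric n M} {p : M} {C : ℝ}
    (h : ∀ v : TangentSpace (𝓡 n) p, g₂.inner p v v ≤ C * g₁.inner p v v) (x₀ : M)
    (c : Fin n → ℝ) :
    c ⬝ᵥ coordMatrix g₂ x₀ p *ᵥ c ≤ C * (c ⬝ᵥ coordMatrix g₁ x₀ p *ᵥ c) := by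
  rw [← inner_sum_coordVector, ← inner_sum_coordVector]
  exact h _

theorem densityRatio_sq (g₁ g₂ : Metric n M) (p : M) :
    densityRatio g₁ g₂ p ^ 2 = (coordMatrix g₂ p p).det / (coordMatrix g₁ p p).det := by
  rw [densityRatio, volDensity, volDensity, div_pow,
    Real.sq_sqrt (posDef_coordMatrix g₂ (mem_frameDomain n p)).det_pos.le,
    Real.sq_sqrt (posDef_coordMatrix g₁ (mem_frameDomain n p)).det_pos.le]

theorem densityRatio_le {g₁ g₂ : Metric n M} {p : M} {C : ℝ}
    (h : ∀ v : TangentSpace (𝓡 n) p, g₂.inner p v v ≤ C * g₁.inner p v v) :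
    densityRatio g₁ g₂ p ≤ Real.sqrt (C ^ n) := by
  refine Real.le_sqrt_of_sq_le ?_
  have h₁ := posDef_coordMatrix g₁ (mem_frameDomain n p)
  rw [densityRatio_sq, div_le_iff₀ h₁.det_pos]
  exact h₁.det_le_pow_mul_det (posDef_coordMatrix g₂ (mem_frameDomain n p))
    (dotProduct_coordMatrix_le h p)

theorem densityRatio_sq_mul_inner_le {g₁ g₂ : Metric n M} {p : M} {C : ℝ} (hC : 0 < C)
    (h : ∀ v : TangentSpace (𝓡 n) p, g₂.inner p v v ≤ C * g₁.inner p v v)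
    (v : TangentSpace (𝓡 n) p) :
    densityRatio g₁ g₂ p ^ 2 * g₁.inner p v v ≤
      (C ^ (((n : ℝ) - 1) / 2)) ^ 2 * g₂.inner p v v := by
  obtain ⟨c, rfl⟩ : ∃ c : Fin n → ℝ, v = ∑ i, c i • coordVector p p i :=
    ⟨_, eq_sum_coordVector (mem_frameDomain n p) v⟩
  rw [inner_sum_coordVector, inner_sum_coordVector]
  -- For `n = 0` the truncated `n - 1` differs from the real exponent, but both forms are empty
  -- sums.
  rcases Nat.eq_zero_or_pos n with rfl | hn
  · simp [dotProduct]
  have hpow : (C ^ (((n : ℝ) - 1) / 2)) ^ 2 = C ^ (n - 1) := by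
    rw [← Real.rpow_natCast, ← Real.rpow_mul hC.le, ← Real.rpow_natCast, Nat.cast_sub hn]
    congr 1
    push_cast
    ring
  have h₁ := posDef_coordMatrix g₁ (mem_frameDomain n p)
  have key := h₁.det_mul_dotProduct_le (posDef_coordMatrix g₂ (mem_frameDomain n p))
    (dotProduct_coordMatrix_le h p) c
  rw [hpow, densityRatio_sq, div_mul_eq_mul_div, div_le_iff₀ h₁.det_pos]
  linarith

/-! ### Transfer of divergences and test fields. -/

theorem coordComponent_smul (x₀ : M) (f : M → ℝ) (Y : ∀ p : M, TangentSpace (𝓡 n) p)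
    (i : Fin n) (p : M) :
    coordComponent x₀ (fun q => f q • Y q) i p = f p * coordComponent x₀ Y i p := by
  simp [coordComponent]

/-- Multiplying a vector field by a constant multiple of the density of `dV_{g₂}` with respect to
`dV_{g₁}` turns its `g₂`-divergence into a `g₁`-divergence. -/
theorem divergence_densityRatio_smul (g₁ g₂ : Metric n M) (c : ℝ)
    (Y : ∀ p : M, TangentSpace (𝓡 n) p) (p : M) :
    divergence g₁ (fun q => (c * densityRatio g₁ g₂ q) • Y q) p =
      c * (densityRatio g₁ g₂ p * divergence g₂ Y p) := by
  -- The density ratio turns √det g₁ into √det g₂ under the derivative, so only the constant `c` has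
  -- to be pulled out and no product rule is needed.
  have hterm (i : Fin n) :
      (fun y : EuclideanSpace ℝ (Fin n) => volDensity g₁ p ((extChartAt (𝓡 n) p).symm y) *
        coordComponent p (fun q => (c * densityRatio g₁ g₂ q) • Y q) i
          ((extChartAt (𝓡 n) p).symm y)) =ᶠ[𝓝 (extChartAt (𝓡 n) p p)]
      c • fun y : EuclideanSpace ℝ (Fin n) => volDensity g₂ p ((extChartAt (𝓡 n) p).symm y) *
        coordComponent p Y i ((extChartAt (𝓡 n) p).symm y) := by
    filter_upwards [extChartAt_target_mem_nhds (I := 𝓡 n) p] with y hy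
    have hq : (extChartAt (𝓡 n) p).symm y ∈ frameDomain n p := by
      rw [frameDomain_eq_source]
      exact (extChartAt (𝓡 n) p).map_target hy
    rw [coordComponent_smul, Pi.smul_apply, smul_eq_mul, volDensity_eq_mul g₁ g₂ hq]
    ring
  have hsum := Finset.sum_congr (s₁ := Finset.univ) rfl fun (i : Fin n) _ =>
    congrArg (fun L : EuclideanSpace ℝ (Fin n) →L[ℝ] ℝ => L (EuclideanSpace.single i 1))
      ((hterm i).fderiv_eq.trans (congrFun (fderiv_const_smul_field c) _))
  simp only [Pi.smul_apply, _root_.smul_apply, smul_eq_mul, ← Finset.mul_sum] at hsum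
  rw [divergence, hsum, divergence, densityRatio]
  have h₂ := (volDensity_pos g₂ (mem_frameDomain n p)).ne'
  field_simp

theorem IsTestField.densityRatio_smul {g₁ g₂ : Metric n M} {C : ℝ} (hC : 0 < C)
    (h : ∀ (p : M) (v : TangentSpace (𝓡 n) p), g₂.inner p v v ≤ C * g₁.inner p v v)
    {Y : ∀ p : M, TangentSpace (𝓡 n) p} (hY : IsTestField g₂ Y) :
    IsTestField g₁ fun q => ((C ^ (((n : ℝ) - 1) / 2))⁻¹ * densityRatio g₁ g₂ q) • Y q where
  smooth := (contMDiff_const.mul (contMDiff_densityRatio g₁ g₂)).smul_section hY.smooth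
  compact_support := by
    have hk : C ^ (((n : ℝ) - 1) / 2) ≠ 0 := (Real.rpow_pos_of_pos hC _).ne'
    have hρ (p : M) : densityRatio g₁ g₂ p ≠ 0 := (densityRatio_pos g₁ g₂ p).ne'
    simpa [hk, hρ] using hY.compact_support
  norm_le_one p := by
    have hk : 0 < C ^ (((n : ℝ) - 1) / 2) := Real.rpow_pos_of_pos hC _
    have hY1 := hY.norm_le_one p
    rw [Real.sqrt_le_iff, one_pow] at hY1 ⊢
    refine ⟨zero_le_one, ?_⟩
    have key := densityRatio_sq_mul_inner_le hC (h p) (Y p)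
    simp only [map_smul, _root_.smul_apply, smul_eq_mul]
    calc _ = ((C ^ (((n : ℝ) - 1) / 2)) ^ 2)⁻¹ *
          (densityRatio g₁ g₂ p ^ 2 * g₁.inner p (Y p) (Y p)) := by ring
      _ ≤ ((C ^ (((n : ℝ) - 1) / 2)) ^ 2)⁻¹ * (C ^ (((n : ℝ) - 1) / 2)) ^ 2 := by
        refine mul_le_mul_of_nonneg_left (key.trans ?_) (by positivity)
        exact mul_le_of_le_one_right (by positivity) hY1.2
      _ = 1 := inv_mul_cancel₀ (by positivity)

/-! ### Comparability of metrics on compact manifolds. -/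

theorem eventually_inner_le (g₁ g₂ : Metric n M) (x₀ : M) :
    ∃ C : ℝ, ∀ᶠ p in 𝓝 x₀, ∀ v : TangentSpace (𝓡 n) p,
      g₂.inner p v v ≤ C * g₁.inner p v v := by
  have hc (g : Metric n M) : ContinuousAt (coordMatrix g x₀) x₀ :=
    continuousAt_pi.mpr fun i => continuousAt_pi.mpr fun j =>
      (contMDiffAt_coordMatrix g (mem_frameDomain n x₀) i j).continuousAt
  have hinv : ContinuousAt (fun p => (coordMatrix g₁ x₀ p)⁻¹) x₀ := by
    refine (continuousAt_matrix_inv _ ?_).comp (hc g₁)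
    rw [Ring.inverse_eq_inv']
    exact continuousAt_inv₀ (posDef_coordMatrix g₁ (mem_frameDomain n x₀)).det_pos.ne'
  have htr : ContinuousAt
      (fun p => ((coordMatrix g₁ x₀ p)⁻¹ * coordMatrix g₂ x₀ p).trace) x₀ :=
    continuous_id.matrix_trace.continuousAt.comp (hinv.mul (hc g₂))
  refine ⟨((coordMatrix g₁ x₀ x₀)⁻¹ * coordMatrix g₂ x₀ x₀).trace + 1, ?_⟩
  filter_upwards [htr.eventually_lt_const (lt_add_one _),
    (isOpen_frameDomain x₀).mem_nhds (mem_frameDomain n x₀)] with p hlt hp v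
  refine le_trans ?_ (mul_le_mul_of_nonneg_right hlt.le (inner_self_nonneg g₁ p v))
  obtain ⟨c, rfl⟩ : ∃ c : Fin n → ℝ, v = ∑ i, c i • coordVector x₀ p i :=
    ⟨_, eq_sum_coordVector hp v⟩
  rw [inner_sum_coordVector, inner_sum_coordVector]
  exact (posDef_coordMatrix g₁ hp).dotProduct_le_trace_mul (posDef_coordMatrix g₂ hp) c

/-- Any two metrics on a compact manifold are comparable. -/
theorem exists_inner_le [CompactSpace M] (g₁ g₂ : Metric n M) :
    ∃ C : ℝ, 0 < C ∧ ∀ (p : M) (v : TangentSpace (𝓡 n) p),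
      g₂.inner p v v ≤ C * g₁.inner p v v := by
  have key : ∃ C : ℝ, 0 < C ∧ ∀ p ∈ (univ : Set M), ∀ v : TangentSpace (𝓡 n) p,
      g₂.inner p v v ≤ C * g₁.inner p v v := by
    -- Having a comparison constant passes to subsets and finite unions, so local constants suffice.
    refine isCompact_univ.induction_on (p := fun s : Set M => ∃ C : ℝ, 0 < C ∧ ∀ p ∈ s,
      ∀ v : TangentSpace (𝓡 n) p, g₂.inner p v v ≤ C * g₁.inner p v v) ?_ ?_ ?_ ?_
    · exact ⟨1, one_pos, fun p hp => hp.elim⟩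
    · rintro s t hst ⟨C, hC, h⟩
      exact ⟨C, hC, fun p hp => h p (hst hp)⟩
    · rintro s t ⟨C, hC, h⟩ ⟨D, hD, h'⟩
      refine ⟨C + D, add_pos hC hD, fun p hp v => ?_⟩
      have h0 := inner_self_nonneg g₁ p v
      rcases hp with hp | hp
      · nlinarith [h p hp v]
      · nlinarith [h' p hp v]
    · intro x₀ _
      obtain ⟨C, hC⟩ := eventually_inner_le g₁ g₂ x₀
      refine ⟨_, mem_nhdsWithin_of_mem_nhds hC, max C 1, by positivity, fun p hp v => ?_⟩
      exact (hp v).trans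
        (mul_le_mul_of_nonneg_right (le_max_left _ _) (inner_self_nonneg g₁ p v))
  obtain ⟨C, hC, h⟩ := key
  exact ⟨C, hC, fun p => h p (mem_univ p)⟩

/-! ### Comparison of volumes and perimeters. -/

variable [MeasurableSpace M] [BorelSpace M]

theorem measurable_densityRatio (g₁ g₂ : Metric n M) : Measurable (densityRatio g₁ g₂) :=
  (contMDiff_densityRatio g₁ g₂).continuous.measurable

theorem chartVolume_eq_withDensity (g₁ g₂ : Metric n M) (x₀ : M) :
    chartVolume g₂ x₀ =
      (chartVolume g₁ x₀).withDensity fun p => ENNReal.ofReal (densityRatio g₁ g₂ p) := by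
  have hsymm : AEMeasurable (extChartAt (𝓡 n) x₀).symm
      ((volume : Measure (EuclideanSpace ℝ (Fin n))).restrict (extChartAt (𝓡 n) x₀).target) :=
    (continuousOn_extChartAt_symm x₀).aemeasurable (isOpen_extChartAt_target x₀).measurableSet
  have hmeas : MeasurableSet (frameDomain n x₀) := (isOpen_frameDomain x₀).measurableSet
  -- Continuity of `volDensity` and its transformation rule are known only on the chart domain,
  -- which carries the whole pushforward measure.
  have hmem : ∀ᵐ p ∂((volume : Measure (EuclideanSpace ℝ (Fin n))).restrict
      (extChartAt (𝓡 n) x₀).target).map (extChartAt (𝓡 n) x₀).symm, p ∈ frameDomain n x₀ := by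
    refine (ae_map_iff hsymm hmeas).mpr ?_
    filter_upwards [ae_restrict_mem (isOpen_extChartAt_target x₀).measurableSet] with y hy
    change _ ∈ frameDomain n x₀
    rw [frameDomain_eq_source]
    exact (extChartAt (𝓡 n) x₀).map_target hy
  have hcont : ContinuousOn (volDensity g₁ x₀) (frameDomain n x₀) := fun p hp =>
    (contMDiffAt_volDensity g₁ hp).continuousAt.continuousWithinAt
  have hae := hcont.aemeasurable (μ := ((volume : Measure (EuclideanSpace ℝ (Fin n))).restrict
      (extChartAt (𝓡 n) x₀).target).map (extChartAt (𝓡 n) x₀).symm) hmeas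
  rw [Measure.restrict_eq_self_of_ae_mem hmem] at hae
  rw [chartVolume, chartVolume, ← withDensity_mul₀ hae.ennreal_ofReal
    (measurable_densityRatio g₁ g₂).ennreal_ofReal.aemeasurable]
  refine withDensity_congr_ae ?_
  filter_upwards [hmem] with p hp
  rw [volDensity_eq_mul g₁ g₂ hp, ENNReal.ofReal_mul (densityRatio_pos g₁ g₂ p).le, mul_comm]
  rfl

theorem riemannianVolume_eq_withDensity (g₁ g₂ : Metric n M) :
    riemannianVolume g₂ =
      (riemannianVolume g₁).withDensity fun p => ENNReal.ofReal (densityRatio g₁ g₂ p) := by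
  rw [riemannianVolume, riemannianVolume, Measure.iSup_withDensity _
    (measurable_densityRatio g₁ g₂).ennreal_ofReal
    (fun p => (ENNReal.ofReal_pos.mpr (densityRatio_pos g₁ g₂ p)).ne')
    fun p => ENNReal.ofReal_ne_top]
  exact iSup_congr fun x₀ => chartVolume_eq_withDensity g₁ g₂ x₀

theorem riemannianVolume_absolutelyContinuous (g₁ g₂ : Metric n M) :
    riemannianVolume g₂ ≪ riemannianVolume g₁ := by
  rw [riemannianVolume_eq_withDensity g₁ g₂]
  exact withDensity_absolutelyContinuous _ _

theorem riemannianVolume_le {g₁ g₂ : Metric n M} {C : ℝ}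
    (h : ∀ (p : M) (v : TangentSpace (𝓡 n) p), g₂.inner p v v ≤ C * g₁.inner p v v) :
    riemannianVolume g₂ ≤ ENNReal.ofReal (Real.sqrt (C ^ n)) • riemannianVolume g₁ := by
  rw [riemannianVolume_eq_withDensity g₁ g₂, ← withDensity_const]
  exact withDensity_mono (.of_forall fun p => ENNReal.ofReal_le_ofReal (densityRatio_le (h p)))

theorem perimeter_le {g₁ g₂ : Metric n M} {C : ℝ} (hC : 0 < C)
    (h : ∀ (p : M) (v : TangentSpace (𝓡 n) p), g₂.inner p v v ≤ C * g₁.inner p v v)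
    {E : Set M} (hE : NullMeasurableSet E (riemannianVolume g₁)) :
    perimeter g₂ E ≤ ENNReal.ofReal (C ^ (((n : ℝ) - 1) / 2)) * perimeter g₁ E := by
  refine iSup₂_le fun Y hY => ?_
  have hk : 0 < C ^ (((n : ℝ) - 1) / 2) := Real.rpow_pos_of_pos hC _
  have hint : ∫ p in E, divergence g₂ Y p ∂riemannianVolume g₂ =
      C ^ (((n : ℝ) - 1) / 2) * ∫ p in E, divergence g₁ (fun q =>
        ((C ^ (((n : ℝ) - 1) / 2))⁻¹ * densityRatio g₁ g₂ q) • Y q) p ∂riemannianVolume g₁ := by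
    rw [riemannianVolume_eq_withDensity g₁ g₂, setIntegral_withDensity_ofReal
      (measurable_densityRatio g₁ g₂) (fun p => (densityRatio_pos g₁ g₂ p).le) hE]
    simp only [divergence_densityRatio_smul]
    rw [integral_const_mul, mul_inv_cancel_left₀ hk.ne']
  rw [hint, ENNReal.ofReal_mul hk.le]
  gcongr
  exact le_iSup₂_of_le _ (hY.densityRatio_smul hC h) le_rfl

theorem HasFinitePerimeter.of_inner_le {g₁ g₂ : Metric n M} {C : ℝ} (hC : 0 < C)
    (h : ∀ (p : M) (v : TangentSpace (𝓡 n) p), g₂.inner p v v ≤ C * g₁.inner p v v)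
    {E : Set M} (hE : HasFinitePerimeter g₁ E) : HasFinitePerimeter g₂ E where
  measurable := hE.measurable.mono_ac (riemannianVolume_absolutelyContinuous g₁ g₂)
  volume_lt_top := (riemannianVolume_le h E).trans_lt
    (ENNReal.mul_lt_top ENNReal.ofReal_lt_top hE.volume_lt_top)
  perimeter_lt_top := (perimeter_le hC h hE.measurable).trans_lt
    (ENNReal.mul_lt_top ENNReal.ofReal_lt_top hE.perimeter_lt_top)

end RiemannianPerimeter

end

theorem mainTheorem6 (n : ℕ) (M : Type*) [TopologicalSpace M] [T2Space M]
    [SecondCountableTopology M] [ChartedSpace (EuclideanSpace ℝ (Fin n)) M]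
    [IsManifold (𝓡 n) ∞ M] [MeasurableSpace M] [BorelSpace M] :
    (∀ (g₁ g₂ : RiemannianPerimeter.Metric n M) (C : ℝ), 1 ≤ C →
      (∀ (p : M) (v : TangentSpace (𝓡 n) p),
        C⁻¹ * g₁.inner p v v ≤ g₂.inner p v v ∧ g₂.inner p v v ≤ C * g₁.inner p v v) →
      ∀ E : Set M, RiemannianPerimeter.HasFinitePerimeter g₁ E →
        RiemannianPerimeter.HasFinitePerimeter g₂ E ∧
        ENNReal.ofReal (C ^ (-(((n : ℝ) - 1) / 2))) * RiemannianPerimeter.perimeter g₁ E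
          ≤ RiemannianPerimeter.perimeter g₂ E ∧
        RiemannianPerimeter.perimeter g₂ E
          ≤ ENNReal.ofReal (C ^ (((n : ℝ) - 1) / 2)) * RiemannianPerimeter.perimeter g₁ E) ∧
    (CompactSpace M → ∀ g₁ g₂ : RiemannianPerimeter.Metric n M,
      {E : Set M | RiemannianPerimeter.HasFinitePerimeter g₁ E} =
        {E : Set M | RiemannianPerimeter.HasFinitePerimeter g₂ E}) := by
  refine ⟨fun g₁ g₂ C hC h E hE => ?_, fun _ g₁ g₂ => ?_⟩
  · have hC0 : 0 < C := one_pos.trans_le hC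
    -- The lower bound is the upper bound with the metrics exchanged.
    have h₂₁ (p : M) (v : TangentSpace (𝓡 n) p) : g₁.inner p v v ≤ C * g₂.inner p v v :=
      (inv_mul_le_iff₀ hC0).mp (h p v).1
    have hE₂ := hE.of_inner_le hC0 fun p v => (h p v).2
    refine ⟨hE₂, ?_, RiemannianPerimeter.perimeter_le hC0 (fun p v => (h p v).2) hE.measurable⟩
    calc _ ≤ ENNReal.ofReal (C ^ (-(((n : ℝ) - 1) / 2))) *
          (ENNReal.ofReal (C ^ (((n : ℝ) - 1) / 2)) * RiemannianPerimeter.perimeter g₂ E) := by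
          gcongr
          exact RiemannianPerimeter.perimeter_le hC0 h₂₁ hE₂.measurable
      _ = RiemannianPerimeter.perimeter g₂ E := by
          rw [← mul_assoc, ← ENNReal.ofReal_mul (Real.rpow_nonneg hC0.le _),
            ← Real.rpow_add hC0, neg_add_cancel, Real.rpow_zero, ENNReal.ofReal_one, one_mul]
  -- Each inclusion needs only a one-sided comparison, so the two constants need not agree.
  · obtain ⟨C, hC, h⟩ := RiemannianPerimeter.exists_inner_le g₁ g₂
    obtain ⟨D, hD, h'⟩ := RiemannianPerimeter.exists_inner_le g₂ g₁
    exact Set.Subset.antisymm (fun E hE => hE.of_inner_le hC h) fun E hE => hE.of_inner_le hD h'
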